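/- Let $G=(V,E)$ be a finite directed graph with $n=|V|$ nodes and let $f$ be an integer with $0<f<n$. A path in $G$ is a sequence of distinct nodes in which each node but the last has an edge to the next one; its first node is its source, its last node is its terminal, and the other nodes are its internal nodes. For $F\subseteq V$ and disjoint $A,B\subseteq V$ write $A\xrightarrow{F}B$ if for every $v\in B$ there are $f+1$ paths in $G$, each with source in $A$ and terminal $v$ and with no internal node in $F$, such that any two of them have no node in common except $v$. The graph $G$ satisfies condition SC if for every $F\subseteq V$ with $|F|\le f$ and every partition $(A,B)$ of $V$ with $A\setminus F\neq\emptyset$ and $B\setminus F\neq\emptyset$, we have $A\xrightarrow{F}B\setminus F$ or $B\xrightarrow{F}A\setminus F$. In the synchronous local broadcast model on $G$, in each round every node $u$ broadcasts a message or stays silent, and its broadcast is received identically and correctly by all $v$ with $(u,v)\in E$, each of which knows that it came from $u$. Every node knows $G$ and $f$ and starts with a binary input. A non-faulty node follows a given deterministic algorithm (a finite-state machine with a finite message alphabet): what it broadcasts, its next state and its output depend only on its identity, its input and the broadcasts received from its in-neighbors. At most $f$ nodes are Byzantine faulty; the set of faulty nodes is unknown to the others, and a faulty node may broadcast an arbitrary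 message (or nothing) in each round. The algorithm solves Byzantine consensus tolerating at most $f$ Byzantine faulty nodes if for every set of at most $f$ faulty nodes, all inputs and every behavior of the faulty nodes: 1. (Agreement) all non-faulty nodes output the same value; 2. (Validity) the output of each non-faulty node is the input of some non-faulty node; 3. (Termination) every non-faulty node irrevocably decides on its output after finitely many rounds. **Theorem.** If $G$ satisfies condition SC, then there is an algorithm that solves Byzantine consensus on $G$ under the local broadcast model, tolerating at most $f$ Byzantine faulty nodes. -/

import Mathlib

namespace LocalBroadcast

universe u

/-! ### Paths and condition SC -/

section Graph

variable {V : Type u}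

/-- `p` lists the nodes of a directed path of `G` from some node of `A` to the node `v`. -/
def IsPathFromTo (G : Digraph V) (A : Finset V) (v : V) (p : List V) : Prop :=
  p.IsChain G.Adj ∧ p.Nodup ∧ (∃ a ∈ A, p.head? = some a) ∧ p.getLast? = some v

/-- No internal node of `p` belongs to `X`; the source (first node) and the terminal (last node)
may belong to `X`. -/
def Excludes (X : Finset V) (p : List V) : Prop :=
  ∀ w ∈ p.tail.dropLast, w ∉ X

/-- For every `v ∈ B` there are `f + 1` paths from `A` to `v` in `G` that exclude `X` and pairwise
have no node in common except `v`. Meant for disjoint `A` and `B`; the sources of the paths are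
then different nodes of `A`. -/
def Propagates (G : Digraph V) (f : ℕ) (X A B : Finset V) : Prop :=
  ∀ v ∈ B, ∃ P : Fin (f + 1) → List V,
    (∀ i, IsPathFromTo G A v (P i) ∧ Excludes X (P i)) ∧
    ∀ i j, i ≠ j → ∀ w, w ∈ P i → w ∈ P j → w = v

variable [Fintype V] [DecidableEq V]

/-- Condition SC with parameter `F`. -/
def ConditionSCWith (G : Digraph V) (f : ℕ) (F : Finset V) : Prop :=
  ∀ A B : Finset V, A ∪ B = Finset.univ → Disjoint A B →
    (A \ F).Nonempty → (B \ F).Nonempty →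
    Propagates G f F A (B \ F) ∨ Propagates G f F B (A \ F)

/-- Condition SC. -/
def ConditionSC (G : Digraph V) (f : ℕ) : Prop :=
  ∀ F : Finset V, F.card ≤ f → ConditionSCWith G f F

end Graph

/-! ### Synchronous algorithms under local broadcast -/

/-- A deterministic synchronous algorithm on the network `G`, where every node broadcasts at most
one message per round. The components may depend on `G` and on the identity of the node, but the
node learns the rest of the execution only through the messages of its in-neighbors.
States and messages range over finite sets, so that the algorithm is given by finite tables. -/
structure Algorithm {V : Type u} (G : Digraph V) where
  /-- Message alphabet. -/
  Msg : Type u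
  /-- Local states of the nodes. -/
  State : Type u
  finite_msg : Finite Msg
  finite_state : Finite State
  /-- Initial state of a node with a given binary input. -/
  init : V → Bool → State
  /-- What a node in a given state broadcasts in the current round; `none` is silence. -/
  send : V → State → Option Msg
  /-- New state of node `v`, from its old state and what its in-neighbors broadcast. -/
  next : (v : V) → State → ({w : V // G.Adj w v} → Option Msg) → State
  /-- Output of a node in a given state; `none` as long as the node has not decided. -/
  output : V → State → Option Bool

namespace Algorithm

variable {V : Type u} [DecidableEq V] {G : Digraph V} (alg : Algorithm G)

/-- What each node broadcasts, given the current states, if `F` is the set of faulty nodes and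
these broadcast `b`. Each node has one broadcast, which all its out-neighbors receive. -/
def broadcast (F : Finset V) (b : V → Option alg.Msg) (s : V → alg.State) (v : V) :
    Option alg.Msg :=
  if v ∈ F then b v else alg.send v (s v)

/-- The states after `t` rounds, in the execution with inputs `x` and faulty set `F` in which
the faulty nodes broadcast `byz t` in round `t`. The input and the states of a faulty node have
no influence on the other nodes. -/
def states (F : Finset V) (x : V → Bool) (byz : ℕ → V → Option alg.Msg) :
    ℕ → V → alg.State
  | 0 => fun v => alg.init v (x v)
  | t + 1 => fun v =>
      alg.next v (states F x byz t v)
        (fun w => alg.broadcast F (byz t) (states F x byz t) w)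

/-- In this execution node `v` decides on `b` after finitely many rounds, for good. -/
def Decides (F : Finset V) (x : V → Bool) (byz : ℕ → V → Option alg.Msg) (v : V) (b : Bool) :
    Prop :=
  ∃ t : ℕ, (∀ s < t, alg.output v (alg.states F x byz s v) = none) ∧
    ∀ s ≥ t, alg.output v (alg.states F x byz s v) = some b

/-- The algorithm solves Byzantine consensus with at most `f` faulty nodes: agreement, validity
and termination hold in every execution. -/
structure SolvesConsensus (f : ℕ) : Prop where
  agreement : ∀ (F : Finset V) (x : V → Bool) (byz : ℕ → V → Option alg.Msg), F.card ≤ f →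
    ∀ v ∉ F, ∀ w ∉ F, ∀ b c : Bool,
      alg.Decides F x byz v b → alg.Decides F x byz w c → b = c
  validity : ∀ (F : Finset V) (x : V → Bool) (byz : ℕ → V → Option alg.Msg), F.card ≤ f →
    ∀ v ∉ F, ∀ b : Bool, alg.Decides F x byz v b → ∃ w ∉ F, x w = b
  termination : ∀ (F : Finset V) (x : V → Bool) (byz : ℕ → V → Option alg.Msg), F.card ≤ f →
    ∀ v ∉ F, ∃ b : Bool, alg.Decides F x byz v b

end Algorithm

/-- Byzantine consensus under local broadcast, tolerating at most `f` faulty nodes, is achievable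
on `G`. -/
def ConsensusAchievable {V : Type u} [DecidableEq V] (G : Digraph V) (f : ℕ) : Prop :=
  ∃ alg : Algorithm G, alg.SolvesConsensus f

end LocalBroadcast

namespace LocalBroadcast

universe u

/-! ### Protocols with a common clock -/

/-! The protocol tries every set `F` of nodes as a guess of the faulty set. One guess must produce
agreement, and the others must do no harm.

No guess does harm: a node changes its value only to one received along `f + 1` paths that are
disjoint except at the node itself. One of them avoids all faulty nodes, so each new value is an old
value of a non-faulty node (`adopt_eq_nonfaulty`). This gives validity and preserves any agreement
reached.

For the correct guess, local broadcast forces even a faulty node to start a flooding phase with a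
single value, which travels unaltered along all routes whose internal nodes avoid `F`
(`floodState_phaseStep`). Let the core be the set of nodes with such routes to every node outside
`F`. Its values are common knowledge, so all non-faulty nodes split the network in the same way. SC
makes one side propagate to the other, which unifies the core outside `F` (`PhaseStep.splitRule`).
SC also makes this part of the core nonempty and propagating to the remaining non-faulty nodes
(`core_sdiff_nonempty`, `propagates_core`), which then adopt its value. -/

/-- A protocol whose local rules may depend on the number of the current round, and in which every
node broadcasts its whole local data in each round. -/
structure ClockedProtocol {V : Type u} (G : Digraph V) where
  /-- Local data of the nodes. -/
  Data : Type u
  finite_data : Finite Data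
  /-- Initial data of a node with a given binary input. -/
  init : V → Bool → Data
  /-- New data of a node after a given round. -/
  next : ℕ → (v : V) → Data → ({w : V // G.Adj w v} → Option Data) → Data
  /-- Value on which a node decides when the clock stops. -/
  output : Data → Bool

namespace ClockedProtocol

variable {V : Type u} {G : Digraph V} (π : ClockedProtocol G)

/-- The algorithm that runs a clocked protocol for `N` rounds and then decides. -/
def toAlgorithm (N : ℕ) : Algorithm G where
  Msg := π.Data
  State := Fin (N + 1) × π.Data
  finite_msg := π.finite_data
  finite_state := by
    have := π.finite_data
    infer_instance
  init v b := (0, π.init v b)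
  send _ s := some s.2
  next v s m :=
    if h : s.1.val < N then (⟨s.1.val + 1, by omega⟩, π.next s.1.val v s.2 m) else s
  output _ s := if s.1.val < N then none else some (π.output s.2)

variable [DecidableEq V]

/-- What each node broadcasts in a round that starts with data `d`. -/
def broadcast (F : Finset V) (b : V → Option π.Data) (d : V → π.Data) (v : V) : Option π.Data :=
  if v ∈ F then b v else some (d v)

/-- The local data after `t` rounds. -/
def data (F : Finset V) (x : V → Bool) (byz : ℕ → V → Option π.Data) : ℕ → V → π.Data
  | 0 => fun v => π.init v (x v)
  | t + 1 => fun v =>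
      π.next t v (data F x byz t v) (fun w => π.broadcast F (byz t) (data F x byz t) w)

variable {π}

/-- The state of a node after `t` rounds: the clock, which stops at `N`, and the local data. -/
def clockState (π : ClockedProtocol G) (N : ℕ) (F : Finset V) (x : V → Bool)
    (byz : ℕ → V → Option π.Data) (t : ℕ) (v : V) : Fin (N + 1) × π.Data :=
  (π.toAlgorithm N).states F x byz t v

theorem clockState_succ {N : ℕ} (F : Finset V) (x : V → Bool) (byz : ℕ → V → Option π.Data)
    (t : ℕ) (v : V) :
    clockState π N F x byz (t + 1) v =
      if h : (clockState π N F x byz t v).1.val < N then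
        (⟨(clockState π N F x byz t v).1.val + 1, by omega⟩,
          π.next (clockState π N F x byz t v).1.val v (clockState π N F x byz t v).2
            (fun w => π.broadcast F (byz t) (fun w => (clockState π N F x byz t w).2) w))
      else clockState π N F x byz t v :=
  rfl

/-- All clocks show the round number until they stop, which is why messages need not carry it. -/
theorem clockState_eq {N : ℕ} (F : Finset V) (x : V → Bool) (byz : ℕ → V → Option π.Data)
    (t : ℕ) (v : V) :
    clockState π N F x byz t v = (⟨min t N, by omega⟩, π.data F x byz (min t N) v) := by
  induction t generalizing v with
  | zero =>
    have h : clockState π N F x byz 0 v = (0, π.init v (x v)) := rfl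
    simp [h, data]
  | succ t ih =>
    rw [clockState_succ]
    simp only [ih]
    by_cases h : t < N
    · simp only [min_eq_left h.le, h, dif_pos, min_eq_left (show t + 1 ≤ N by omega)]
      rfl
    · simp only [min_eq_right (not_lt.1 h), lt_irrefl, dif_neg, not_false_eq_true,
        min_eq_right (show N ≤ t + 1 by omega)]

theorem output_toAlgorithm {N : ℕ} (F : Finset V) (x : V → Bool) (byz : ℕ → V → Option π.Data)
    (t : ℕ) (v : V) :
    (π.toAlgorithm N).output v ((π.toAlgorithm N).states F x byz t v) =
      if t < N then none else some (π.output (π.data F x byz N v)) := by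
  have h : (π.toAlgorithm N).output v ((π.toAlgorithm N).states F x byz t v) =
      if (clockState π N F x byz t v).1.val < N then none
      else some (π.output (clockState π N F x byz t v).2) := rfl
  rw [h, clockState_eq]
  by_cases ht : t < N
  · rw [if_pos ht, if_pos (by simpa using ht)]
  · rw [if_neg ht, if_neg (by simpa using ht)]
    simp only [min_eq_right (not_lt.1 ht)]

theorem decides_toAlgorithm_iff {N : ℕ} {F : Finset V} {x : V → Bool}
    {byz : ℕ → V → Option π.Data} {v : V} {b : Bool} :
    (π.toAlgorithm N).Decides F x byz v b ↔ π.output (π.data F x byz N v) = b := by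
  constructor
  · rintro ⟨t, -, h⟩
    have := h (max t N) (le_max_left _ _)
    rw [output_toAlgorithm, if_neg (by omega)] at this
    exact Option.some.inj this
  · rintro rfl
    refine ⟨N, fun s hs => ?_, fun s hs => ?_⟩
    · rw [output_toAlgorithm, if_pos hs]
    · rw [output_toAlgorithm, if_neg (by omega)]

theorem solvesConsensus_toAlgorithm {N f : ℕ}
    (h : ∀ (F : Finset V) (x : V → Bool) (byz : ℕ → V → Option π.Data), F.card ≤ f →
      (∀ v ∉ F, ∀ w ∉ F, π.output (π.data F x byz N v) = π.output (π.data F x byz N w)) ∧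
      ∀ v ∉ F, ∃ w ∉ F, x w = π.output (π.data F x byz N v)) :
    (π.toAlgorithm N).SolvesConsensus f where
  agreement F x byz hF v hv w hw b c hb hc := by
    rw [← decides_toAlgorithm_iff.1 hb, ← decides_toAlgorithm_iff.1 hc]
    exact (h F x byz hF).1 v hv w hw
  validity F x byz hF v hv b hb := by
    rw [← decides_toAlgorithm_iff.1 hb]
    exact (h F x byz hF).2 v hv
  termination F x byz _ v _ := ⟨_, decides_toAlgorithm_iff.2 rfl⟩

end ClockedProtocol

/-! ### Routes -/

section Route

variable {V : Type u} {G : Digraph V}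

/-- `Route G F v l u`: the list `l` leads backwards from `v` to `u` along edges of `G`, and the
nodes strictly between `v` and `u` are not in `F`. -/
inductive Route (G : Digraph V) (F : Finset V) : V → List V → V → Prop
  | nil (v : V) : Route G F v [] v
  | edge {u v : V} : G.Adj u v → Route G F v [u] u
  | cons {u v w : V} {l : List V} : G.Adj w v → w ∉ F → Route G F w l u → Route G F v (w :: l) u

/-- Routes may repeat nodes, so they concatenate freely; only the junction becomes a new internal
node. -/
theorem Route.trans {F : Finset V} {u v w : V} {l l' : List V} (h : Route G F v l w) (hw : w ∉ F)
    (h' : Route G F w l' u) : Route G F v (l ++ l') u := by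
  induction h with
  | nil => exact h'
  | edge e => exact .cons e hw h'
  | cons e hx _ ih => exact .cons e hx (ih hw h')

theorem Route.of_isChain {F : Finset V} {a : V} {m : List V} (hm : ∀ w ∈ m, w ∉ F) {v : V}
    (h : (a :: (m ++ [v])).IsChain G.Adj) : Route G F v (m.reverse ++ [a]) a := by
  induction m using List.reverseRecOn generalizing v with
  | nil => exact .edge (by simpa using h)
  | append_singleton m w ih =>
    have h' : ((a :: (m ++ [w])) ++ [v]).IsChain G.Adj := by simpa using h
    rw [List.isChain_append] at h'
    have hwv : G.Adj w v := h'.2.2 w (by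
      rw [← List.cons_append, List.getLast?_append]; simp) v (by simp)
    simp only [List.reverse_append, List.reverse_singleton, List.cons_append]
    exact .cons hwv (hm w (by simp)) (ih (fun x hx => hm x (by simp [hx])) h'.1)

theorem IsPathFromTo.exists_route {F A : Finset V} {v : V} {p : List V}
    (hp : IsPathFromTo G A v p) (hF : Excludes F p) (hv : v ∉ A) :
    ∃ a ∈ A, a ∈ p ∧ Route G F v p.dropLast.reverse a := by
  obtain ⟨hc, -, ⟨a, ha, hh⟩, hl⟩ := hp
  obtain ⟨q, rfl⟩ : ∃ q, p = a :: q := by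
    cases p with
    | nil => simp at hh
    | cons b q => exact ⟨q, by simpa using hh⟩
  rcases List.eq_nil_or_concat q with rfl | ⟨m, b, rfl⟩
  · simp at hl
    subst hl
    exact absurd ha hv
  · have hb : b = v := by
      rw [List.concat_eq_append, ← List.cons_append, List.getLast?_append] at hl
      simpa using hl
    subst hb
    refine ⟨a, ha, by simp, ?_⟩
    have hm : ∀ w ∈ m, w ∉ F := fun w hw => hF w (by simpa using hw)
    have := Route.of_isChain (G := G) hm (v := b) (a := a) (by simpa using hc)
    rwa [List.concat_eq_append, ← List.cons_append, List.dropLast_concat, List.reverse_cons]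

end Route

/-! ### Flooding -/

section Flooding

variable {V : Type u} {G : Digraph V}

/-- A binary value together with the values received along all backward walks of length at
most `K`. -/
abbrev FloodData (V : Type u) (K : ℕ) : Type u := Bool × ({l : List V // l.length ≤ K} → Bool)

/-- The value that a node with given data has for a given backward walk; the empty walk stands for
the node itself. -/
def FloodData.report {K : ℕ} (d : FloodData V K) : List V → Bool
  | [] => d.1
  | w :: q => if h : (w :: q).length ≤ K then d.2 ⟨w :: q, h⟩ else false

/-- The table of a node after round `r` of a phase: the entries for walks of length `r + 1` are
replaced by what the in-neighbors reported in this round. -/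
noncomputable def floodTable {K : ℕ} (G : Digraph V) (r : ℕ) (v : V) (d : FloodData V K)
    (m : {w : V // G.Adj w v} → Option (FloodData V K)) (l : {l : List V // l.length ≤ K}) :
    Bool :=
  open Classical in
  match l.1 with
  | [] => false
  | w :: q =>
    if q.length = r then
      -- Silence counts as `false`, the same for all receivers, as in `said`.
      if h : G.Adj w v then (m ⟨w, h⟩).elim false (fun d' => d'.report q) else false
    else d.2 l

/-- The protocol that works in phases of `K` rounds. In each phase the values of all nodes are
flooded, and at its end every node computes its new value from what it received. -/
noncomputable def flooding [Finite V] (G : Digraph V) (K : ℕ)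
    (rule : ℕ → V → (List V → Bool) → Bool) : ClockedProtocol G where
  Data := FloodData V K
  finite_data := by
    have : Finite {l : List V // l.length ≤ K} := (List.finite_length_le V K).to_subtype
    infer_instance
  init _ b := (b, fun _ => false)
  next t v d m :=
    (if (t + 1) % K = 0 then
        rule (t / K) v (FloodData.report (d.1, floodTable G (t % K) v d m)) else d.1,
      floodTable G (t % K) v d m)
  output d := d.1

/-- The effect of one phase of flooding on the values of the non-faulty nodes: every node `u`
starts with one value `σ u`, which is received unaltered along all routes without faulty internal
nodes. -/
def PhaseStep (G : Digraph V) (K : ℕ) (F : Finset V) (ρ : V → (List V → Bool) → Bool)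
    (γ γ' : V → Bool) : Prop :=
  ∃ (σ : V → Bool) (view : V → List V → Bool),
    (∀ v ∉ F, σ v = γ v) ∧
    (∀ v ∉ F, ∀ l u, Route G F v l u → l.length ≤ K → view v l = σ u) ∧
    ∀ v ∉ F, γ' v = ρ v (view v)

variable [Fintype V] [DecidableEq V] {K : ℕ} {rule : ℕ → V → (List V → Bool) → Bool}

/-- The data of the nodes after `t` rounds of flooding. -/
noncomputable def floodState (G : Digraph V) (K : ℕ) (rule : ℕ → V → (List V → Bool) → Bool)
    (F : Finset V) (x : V → Bool) (byz : ℕ → V → Option (FloodData V K)) (t : ℕ) (v : V) :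
    FloodData V K :=
  (flooding G K rule).data F x byz t v

/-- The broadcast of a node in round `t` of flooding. -/
noncomputable def floodMsg (G : Digraph V) (K : ℕ) (rule : ℕ → V → (List V → Bool) → Bool)
    (F : Finset V) (x : V → Bool) (byz : ℕ → V → Option (FloodData V K)) (t : ℕ) (v : V) :
    Option (FloodData V K) :=
  if v ∈ F then byz t v else some (floodState G K rule F x byz t v)

/-- What `w` reports about the walk `q` in the round of phase `i` meant for it. -/
noncomputable def said (G : Digraph V) (K : ℕ) (rule : ℕ → V → (List V → Bool) → Bool)
    (F : Finset V) (x : V → Bool) (byz : ℕ → V → Option (FloodData V K)) (i : ℕ) (w : V)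
    (q : List V) : Bool :=
  (floodMsg G K rule F x byz (K * i + q.length) w).elim false fun d => d.report q

variable {F : Finset V} {x : V → Bool} {byz : ℕ → V → Option (FloodData V K)}

theorem floodState_succ (t : ℕ) (v : V) :
    floodState G K rule F x byz (t + 1) v =
      (if (t + 1) % K = 0 then
          rule (t / K) v (FloodData.report ((floodState G K rule F x byz t v).1,
            (floodState G K rule F x byz (t + 1) v).2))
        else (floodState G K rule F x byz t v).1,
        floodTable G (t % K) v (floodState G K rule F x byz t v)
          (fun w => floodMsg G K rule F x byz t w)) :=
  rfl

theorem floodState_fst_of_lt (i r : ℕ) (hr : r < K) (v : V) :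
    (floodState G K rule F x byz (K * i + r) v).1 =
      (floodState G K rule F x byz (K * i) v).1 := by
  induction r with
  | zero => rfl
  | succ r ih =>
    have h : (K * i + r + 1) % K ≠ 0 := by
      rw [add_assoc, Nat.mul_add_mod, Nat.mod_eq_of_lt hr]; omega
    rw [← ih (by omega), ← add_assoc, floodState_succ, if_neg h]

/-- An entry is written once per phase, in round `q.length`, and survives until the phase ends. -/
theorem floodState_snd (i r : ℕ) (hr : r ≤ K) (v w : V) (q : List V)
    (hq : (w :: q).length ≤ K) (hqr : q.length < r) (hw : G.Adj w v) :
    (floodState G K rule F x byz (K * i + r) v).2 ⟨w :: q, hq⟩ =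
      said G K rule F x byz i w q := by
  induction r with
  | zero => omega
  | succ r ih =>
    have hmod : (K * i + r) % K = r := by rw [Nat.mul_add_mod, Nat.mod_eq_of_lt hr]
    rw [← add_assoc, floodState_succ, hmod]
    by_cases h : q.length = r
    · subst h
      simp only [floodTable, if_true, dif_pos hw, said]
    · rw [← ih (by omega) (by omega)]
      simp only [floodTable, if_neg h]

theorem said_of_notMem {i : ℕ} {w : V} (hw : w ∉ F) (q : List V) :
    said G K rule F x byz i w q = (floodState G K rule F x byz (K * i + q.length) w).report q := by
  rw [said, floodMsg, if_neg hw]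
  rfl

theorem said_nil {i : ℕ} {w : V} (hw : w ∉ F) :
    said G K rule F x byz i w [] = (floodState G K rule F x byz (K * i) w).1 :=
  said_of_notMem hw []

omit [Fintype V] [DecidableEq V] in
theorem report_cons (d : FloodData V K) {u : V} {q : List V} (hq : (u :: q).length ≤ K) :
    d.report (u :: q) = d.2 ⟨u :: q, hq⟩ :=
  dif_pos hq

theorem said_cons {i : ℕ} {u w : V} {q : List V} (hw : w ∉ F) (hu : G.Adj u w)
    (hq : (u :: q).length ≤ K) :
    said G K rule F x byz i w (u :: q) = said G K rule F x byz i u q := by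
  rw [said_of_notMem hw, report_cons _ hq]
  exact floodState_snd i _ hq w u q hq (by simp) hu

/-- Non-faulty relays are peeled off one by one. The origin `u` may be faulty, but its broadcast in
the first round of the phase is the same for all out-neighbors. -/
theorem said_of_route {i : ℕ} {u v : V} {l : List V} (h : Route G F v l u) (hv : v ∉ F)
    (hl : l.length ≤ K) :
    said G K rule F x byz i v l = said G K rule F x byz i u [] := by
  induction h with
  | nil => rfl
  | edge e => exact said_cons hv e hl
  | cons e hw _ ih =>
    rw [said_cons hv e hl]
    exact ih hw (by simp at hl; omega)

theorem floodState_phaseStep (hK : 0 < K) (i : ℕ) :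
    PhaseStep G K F (rule i) (fun v => (floodState G K rule F x byz (K * i) v).1)
      (fun v => (floodState G K rule F x byz (K * (i + 1)) v).1) := by
  refine ⟨fun u => said G K rule F x byz i u [],
    fun v => FloodData.report ((floodState G K rule F x byz (K * i) v).1,
      (floodState G K rule F x byz (K * (i + 1)) v).2), fun v hv => said_nil hv, ?_, ?_⟩
  · intro v hv l u h hl
    change _ = said G K rule F x byz i u []
    rw [← said_of_route h hv hl]
    cases l with
    | nil => rw [said_nil hv]; rfl
    | cons w q =>
      have hw : G.Adj w v := by cases h <;> assumption
      rw [said_cons hv hw hl]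
      refine (report_cons _ hl).trans ?_
      exact floodState_snd i K le_rfl v w q hl hl hw
  · intro v _
    obtain ⟨k, rfl⟩ : ∃ k, K = k + 1 := ⟨K - 1, by omega⟩
    have h0 : ((k + 1) * i + k + 1) % (k + 1) = 0 := by
      rw [add_assoc, Nat.mul_add_mod, Nat.mod_self]
    have h1 : ((k + 1) * i + k) / (k + 1) = i := by
      rw [Nat.mul_add_div (by omega), Nat.div_eq_of_lt (by omega), add_zero]
    have h2 : (k + 1) * (i + 1) = (k + 1) * i + k + 1 := by ring
    dsimp only
    rw [← floodState_fst_of_lt i k (by omega) v, h2]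
    conv_lhs => rw [floodState_succ]
    rw [if_pos h0, h1]

end Flooding

/-! ### Adopting a value received along disjoint paths -/

section Adopt

variable {V : Type u} {G : Digraph V} {f K : ℕ}

/-- In the view of `v`, the value `δ` was received along `f + 1` paths from `A` that exclude `X` and
pairwise have no node in common except `v`. -/
def Confirmed (G : Digraph V) (f : ℕ) (X A : Finset V) (δ : Bool) (v : V)
    (view : List V → Bool) : Prop :=
  ∃ P : Fin (f + 1) → List V,
    (∀ i, IsPathFromTo G A v (P i) ∧ Excludes X (P i)) ∧
    (∀ i j, i ≠ j → ∀ w, w ∈ P i → w ∈ P j → w = v) ∧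
    ∀ i, view (P i).dropLast.reverse = δ

/-- A node outside `A` adopts the value `δ` if it is confirmed, and otherwise keeps its own. -/
noncomputable def adopt (G : Digraph V) (f : ℕ) (X A : Finset V) (δ : Bool) (v : V)
    (view : List V → Bool) : Bool :=
  open Classical in if v ∉ A ∧ Confirmed G f X A δ v view then δ else view []

theorem adopt_of_mem {X A : Finset V} {δ : Bool} {v : V} {view : List V → Bool} (hv : v ∈ A) :
    adopt G f X A δ v view = view [] := by
  simp [adopt, hv]

/-- Pigeonhole: faulty nodes on different paths are different, since the shared node `v` is not
faulty. -/
theorem exists_disjoint_of_paths {F : Finset V} (hF : F.card ≤ f) {v : V} (hv : v ∉ F)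
    {P : Fin (f + 1) → List V} (hP : ∀ i j, i ≠ j → ∀ w, w ∈ P i → w ∈ P j → w = v) :
    ∃ i, ∀ w ∈ P i, w ∉ F := by
  by_contra! h
  choose g hg hgF using h
  have hinj : Function.Injective g := by
    intro i j hij
    by_contra hne
    exact hv (hP i j hne (g i) (hg i) (hij ▸ hg j) ▸ hgF i)
  have := Finset.card_le_card_of_injOn (s := Finset.univ) (t := F) g (fun i _ => hgF i)
    hinj.injOn
  simp at this
  omega

theorem length_relay_le [Fintype V] {A : Finset V} {v : V} {p : List V}
    (hp : IsPathFromTo G A v p) (hK : Fintype.card V ≤ K) : p.dropLast.reverse.length ≤ K := by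
  have := hp.2.1.length_le_card
  simp
  omega

theorem adopt_eq_nonfaulty [Fintype V] {F : Finset V} (hF : F.card ≤ f)
    (hK : Fintype.card V ≤ K) {σ : V → Bool} {view : V → List V → Bool}
    (hview : ∀ v ∉ F, ∀ l u, Route G F v l u → l.length ≤ K → view v l = σ u)
    (X A : Finset V) (δ : Bool) {v : V} (hv : v ∉ F) :
    ∃ w ∉ F, adopt G f X A δ v (view v) = σ w := by
  unfold adopt
  split_ifs with h
  · obtain ⟨hvA, P, hP, hd, hδ⟩ := h
    obtain ⟨i, hi⟩ := exists_disjoint_of_paths hF hv hd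
    have hex : Excludes F (P i) := fun w hw => hi w (List.mem_of_mem_tail (List.mem_of_mem_dropLast hw))
    obtain ⟨a, -, hap, hr⟩ := (hP i).1.exists_route hex hvA
    exact ⟨a, hi a hap, by rw [← hδ i, hview v hv _ a hr (length_relay_le (hP i).1 hK)]⟩
  · exact ⟨v, hv, hview v hv _ v (.nil v) (Nat.zero_le _)⟩

/-- Restricting `hσ` to nodes with a route to `v` matters for the split, where `A` may contain nodes
outside the core with arbitrary values. -/
theorem confirmed_of_paths [Fintype V] {F A : Finset V} (hK : Fintype.card V ≤ K) {σ : V → Bool}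
    {view : V → List V → Bool}
    (hview : ∀ v ∉ F, ∀ l u, Route G F v l u → l.length ≤ K → view v l = σ u)
    {δ : Bool} {v : V} (hv : v ∉ F) (hvA : v ∉ A) {P : Fin (f + 1) → List V}
    (hP : ∀ i, IsPathFromTo G A v (P i) ∧ Excludes F (P i))
    (hd : ∀ i j, i ≠ j → ∀ w, w ∈ P i → w ∈ P j → w = v)
    (hσ : ∀ a ∈ A, (∃ l, Route G F v l a) → σ a = δ) :
    adopt G f F A δ v (view v) = δ := by
  refine if_pos ⟨hvA, P, hP, hd, fun i => ?_⟩
  obtain ⟨a, ha, -, hr⟩ := (hP i).1.exists_route (hP i).2 hvA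
  rw [hview v hv _ a hr (length_relay_le (hP i).1 hK)]
  exact hσ a ha ⟨_, hr⟩

end Adopt

/-! ### The core of the network outside a set of nodes -/

section Core

variable {V : Type u} [Fintype V] [DecidableEq V] {G : Digraph V} {f : ℕ} {F : Finset V}

/-- The nodes that have routes excluding `F` to all nodes outside `F`. -/
noncomputable def core (G : Digraph V) (F : Finset V) : Finset V :=
  open Classical in Finset.univ.filter fun u => ∀ v ∉ F, ∃ l, Route G F v l u

theorem mem_core {u : V} : u ∈ core G F ↔ ∀ v ∉ F, ∃ l, Route G F v l u := by
  simp [core]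

theorem mem_core_of_route {u w : V} {l : List V} (hw : w ∈ core G F \ F)
    (h : Route G F w l u) : u ∈ core G F := by
  rw [Finset.mem_sdiff, mem_core] at hw
  rw [mem_core]
  intro v hv
  obtain ⟨l', h'⟩ := hw.1 v hv
  exact ⟨_, h'.trans hw.2 h⟩

omit [Fintype V] [DecidableEq V] in
theorem Propagates.exists_route {A B : Finset V} (h : Propagates G f F A B)
    (hF : F.card ≤ f) {v : V} (hv : v ∈ B) (hvF : v ∉ F) (hvA : v ∉ A) :
    ∃ a ∈ A, a ∉ F ∧ ∃ l, Route G F v l a := by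
  obtain ⟨P, hP, hd⟩ := h v hv
  obtain ⟨i, hi⟩ := exists_disjoint_of_paths hF hvF hd
  obtain ⟨a, ha, hap, hr⟩ := (hP i).1.exists_route (hP i).2 hvA
  exact ⟨a, ha, hi a hap, _, hr⟩

/-- Take a node `u` outside `F` that reaches the most nodes. If it misses some, apply SC to `reach
u` and its complement: either `u` reaches a missed node after all, or a missed node reaches `u` and
hence strictly more. -/
theorem core_sdiff_nonempty (hG : ConditionSCWith G f F) (hF : F.card ≤ f)
    (hf : f < Fintype.card V) : (core G F \ F).Nonempty := by
  classical
  let reach : V → Finset V := fun u => Finset.univ.filter fun v => v ∉ F ∧ ∃ l, Route G F v l u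
  have hreach : ∀ {u v}, v ∈ reach u ↔ v ∉ F ∧ ∃ l, Route G F v l u := by simp [reach]
  have hne : (Fᶜ).Nonempty := by
    rw [← Finset.card_pos, Finset.card_compl]; omega
  obtain ⟨u, hu, hmax⟩ := Finset.exists_max_image Fᶜ (fun u => (reach u).card) hne
  rw [Finset.mem_compl] at hu
  have huu : u ∈ reach u := hreach.2 ⟨hu, [], .nil u⟩
  by_cases hall : ((reach u)ᶜ \ F).Nonempty
  · exfalso
    rcases hG (reach u) (reach u)ᶜ (Finset.union_compl _) disjoint_compl_right
      ⟨u, Finset.mem_sdiff.2 ⟨huu, hu⟩⟩ hall with h | h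
    · obtain ⟨v, hv⟩ := hall
      obtain ⟨hv1, hv2⟩ := Finset.mem_sdiff.1 hv
      rw [Finset.mem_compl] at hv1
      obtain ⟨a, ha, haF, l, hl⟩ := h.exists_route hF hv hv2 hv1
      obtain ⟨-, l', hl'⟩ := hreach.1 ha
      exact hv1 (hreach.2 ⟨hv2, _, hl.trans haF hl'⟩)
    · obtain ⟨b, hb, hbF, l, hl⟩ := h.exists_route hF (Finset.mem_sdiff.2 ⟨huu, hu⟩) hu
        (by simpa using huu)
      rw [Finset.mem_compl] at hb
      have hlt : reach u ⊂ reach b := by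
        refine (Finset.ssubset_iff_of_subset fun v hv => ?_).2
          ⟨b, hreach.2 ⟨hbF, [], .nil b⟩, hb⟩
        obtain ⟨hvF, l', hl'⟩ := hreach.1 hv
        exact hreach.2 ⟨hvF, _, hl'.trans hu hl⟩
      exact absurd (hmax b (Finset.mem_compl.2 hbF)) (not_le.2 (Finset.card_lt_card hlt))
  · refine ⟨u, Finset.mem_sdiff.2 ⟨mem_core.2 fun v hv => ?_, hu⟩⟩
    by_contra hcon
    exact hall ⟨v, Finset.mem_sdiff.2 ⟨Finset.mem_compl.2 fun h => hcon (hreach.1 h).2, hv⟩⟩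

/-- The other alternative of SC would give a route into the core from a non-faulty node outside it,
but such a node would belong to the core. -/
theorem propagates_core (hG : ConditionSCWith G f F) (hF : F.card ≤ f)
    (hf : f < Fintype.card V) :
    Propagates G f F (core G F \ F) ((core G F \ F)ᶜ \ F) := by
  by_cases hne : ((core G F \ F)ᶜ \ F).Nonempty
  · obtain ⟨z, hz⟩ := core_sdiff_nonempty hG hF hf
    have hzF := (Finset.mem_sdiff.1 hz).2
    have hz' := Finset.mem_sdiff.2 ⟨hz, hzF⟩
    refine (hG _ _ (Finset.union_compl _) disjoint_compl_right ⟨z, hz'⟩ hne).resolve_right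
      fun h => ?_
    obtain ⟨b, hb, hbF, l, hl⟩ := h.exists_route hF hz' hzF (by simpa using hz)
    exact (Finset.mem_compl.1 hb) (Finset.mem_sdiff.2 ⟨mem_core_of_route hz hl, hbF⟩)
  · intro v hv
    exact absurd ⟨v, hv⟩ hne

end Core

/-! ### The rules of the consensus protocol -/

section Rules

variable {V : Type u} [Fintype V] [DecidableEq V] {G : Digraph V} {f K : ℕ} {F : Finset V}

/-- A route from `u` to `v` that excludes `F`, if there is one. -/
noncomputable def route (G : Digraph V) (F : Finset V) (v u : V) : List V :=
  open Classical in if h : ∃ l, Route G F v l u then h.choose else []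

omit [Fintype V] [DecidableEq V] in
theorem route_spec {u v : V} (h : ∃ l, Route G F v l u) : Route G F v (route G F v u) u := by
  rw [route, dif_pos h]
  exact h.choose_spec

/-- A number of rounds that suffices to flood along all paths and all chosen routes. -/
noncomputable def floodLength (G : Digraph V) : ℕ :=
  Fintype.card V + ∑ e : Finset V × V × V, (route G e.1 e.2.1 e.2.2).length

omit [DecidableEq V] in
theorem card_le_floodLength : Fintype.card V ≤ floodLength G := Nat.le_add_right _ _

omit [DecidableEq V] in
theorem length_route_le (F : Finset V) (v u : V) : (route G F v u).length ≤ floodLength G :=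
  (Finset.single_le_sum (f := fun e : Finset V × V × V => (route G e.1 e.2.1 e.2.2).length)
    (fun _ _ => Nat.zero_le _) (Finset.mem_univ (F, v, u))).trans (Nat.le_add_left _ _)

/-- The nodes of the core from which `v` received the value `false`. -/
noncomputable def zeros (G : Digraph V) (F : Finset V) (v : V) (view : List V → Bool) :
    Finset V :=
  (core G F).filter fun u => view (route G F v u) = false

/-- Compare the nodes of the core with value `false` to the rest of the network, and adopt the
value of the part that propagates to the other one. -/
noncomputable def splitRule (G : Digraph V) (f : ℕ) (F : Finset V) (v : V)
    (view : List V → Bool) : Bool :=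
  open Classical in
  if Propagates G f F (zeros G F v view) ((zeros G F v view)ᶜ \ F) then
    adopt G f F (zeros G F v view) false v view
  else adopt G f F (zeros G F v view)ᶜ true v view

/-- For every set `F` in a list of all sets of nodes, there are three phases. -/
noncomputable def consensusRule (G : Digraph V) (f i : ℕ) : V → (List V → Bool) → Bool :=
  -- The default `∅` is reached only after the whole list has been tried.
  let F : Finset V := (Finset.univ : Finset (Finset V)).toList.getD (i / 3) ∅
  if i % 3 = 0 then splitRule G f F
  else adopt G f F (core G F \ F) (decide (i % 3 = 1))

theorem consensusRule_eq_adopt (G : Digraph V) (f i : ℕ) (v : V) (view : List V → Bool) :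
    ∃ X A δ, consensusRule G f i v view = adopt G f X A δ v view := by
  unfold consensusRule
  split_ifs
  · unfold splitRule
    split_ifs
    · exact ⟨_, _, _, rfl⟩
    · exact ⟨_, _, _, rfl⟩
  · exact ⟨_, _, _, rfl⟩

theorem PhaseStep.exists_eq {i : ℕ} {γ γ' : V → Bool} (hF : F.card ≤ f)
    (h : PhaseStep G (floodLength G) F (consensusRule G f i) γ γ') {v : V} (hv : v ∉ F) :
    ∃ w ∉ F, γ' v = γ w := by
  obtain ⟨σ, view, hσ, hview, hγ⟩ := h
  obtain ⟨X, A, δ, hX⟩ := consensusRule_eq_adopt G f i v (view v)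
  obtain ⟨w, hw, h⟩ := adopt_eq_nonfaulty hF card_le_floodLength hview X A δ hv
  exact ⟨w, hw, by rw [hγ v hv, hX, h, hσ w hw]⟩

/-- All non-faulty nodes compute the same set `Z`. Faulty members of the core cause no trouble, as
their `σ` is also seen consistently. -/
theorem PhaseStep.splitRule {γ γ' : V → Bool} (hG : ConditionSCWith G f F)
    (h : PhaseStep G (floodLength G) F (splitRule G f F) γ γ') :
    ∃ b, ∀ v ∈ core G F \ F, γ' v = b := by
  obtain ⟨σ, view, hσ, hview, hγ⟩ := h
  set Z : Finset V := (core G F).filter fun u => σ u = false with hZ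
  have hmem : ∀ u, u ∈ Z ↔ u ∈ core G F ∧ σ u = false := fun u => by simp [hZ]
  have hnil : ∀ v ∉ F, view v [] = σ v := fun v hv => hview v hv _ v (.nil v) (Nat.zero_le _)
  have hzeros : ∀ v ∉ F, zeros G F v (view v) = Z := by
    intro v hv
    refine Finset.filter_congr fun u hu => ?_
    rw [hview v hv _ u (route_spec (mem_core.1 hu v hv)) (length_route_le F v u)]
  by_cases hp : Propagates G f F Z (Zᶜ \ F)
  · refine ⟨false, fun v hv => ?_⟩
    obtain ⟨-, hvF⟩ := Finset.mem_sdiff.1 hv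
    rw [hγ v hvF, LocalBroadcast.splitRule, hzeros v hvF, if_pos hp]
    by_cases hvZ : v ∈ Z
    · rw [adopt_of_mem hvZ, hnil v hvF]
      exact ((hmem v).1 hvZ).2
    · obtain ⟨P, hP, hd⟩ := hp v (Finset.mem_sdiff.2 ⟨Finset.mem_compl.2 hvZ, hvF⟩)
      exact confirmed_of_paths card_le_floodLength hview hvF hvZ hP hd
        fun a ha _ => ((hmem a).1 ha).2
  · refine ⟨true, fun v hv => ?_⟩
    obtain ⟨hvC, hvF⟩ := Finset.mem_sdiff.1 hv
    rw [hγ v hvF, LocalBroadcast.splitRule, hzeros v hvF, if_neg hp]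
    have htrue : ∀ a ∈ Zᶜ, a ∈ core G F → σ a = true := fun a ha hC => by
      simpa [hmem, hC] using ha
    by_cases hvZ : v ∈ Z
    · have hvZF := Finset.mem_sdiff.2 ⟨hvZ, hvF⟩
      have hne : (Zᶜ \ F).Nonempty := by
        -- Propagation to an empty set holds vacuously, against `hp`.
        by_contra hne
        exact hp fun w hw => absurd ⟨w, hw⟩ hne
      obtain ⟨P, hP, hd⟩ := (hG Z Zᶜ (Finset.union_compl _) disjoint_compl_right ⟨v, hvZF⟩
        hne).resolve_left hp v hvZF
      -- A source in `Zᶜ` with a route to the core node `v` is itself in the core, so its value is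
      -- `true`.
      exact confirmed_of_paths card_le_floodLength hview hvF (by simpa using hvZ) hP hd
        fun a ha ⟨l, hl⟩ => htrue a ha (mem_core_of_route hv hl)
    · have hvZ' := Finset.mem_compl.2 hvZ
      rw [adopt_of_mem hvZ', hnil v hvF]
      exact htrue v hvZ' hvC

theorem PhaseStep.adopt_core {γ γ' : V → Bool} {δ : Bool}
    (h : PhaseStep G (floodLength G) F (adopt G f F (core G F \ F) δ) γ γ') :
    ∀ v ∈ core G F \ F, γ' v = γ v := by
  obtain ⟨σ, view, hσ, hview, hγ⟩ := h
  intro v hv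
  have hvF := (Finset.mem_sdiff.1 hv).2
  rw [hγ v hvF, adopt_of_mem hv, hview v hvF _ v (.nil v) (Nat.zero_le _), hσ v hvF]

theorem PhaseStep.adopt_core_eq {γ γ' : V → Bool} {δ : Bool} (hG : ConditionSCWith G f F)
    (hF : F.card ≤ f) (hf : f < Fintype.card V)
    (h : PhaseStep G (floodLength G) F (adopt G f F (core G F \ F) δ) γ γ')
    (hδ : ∀ v ∈ core G F \ F, γ v = δ) : ∀ v ∉ F, γ' v = δ := by
  intro v hvF
  by_cases hv : v ∈ core G F \ F
  · rw [h.adopt_core v hv, hδ v hv]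
  · obtain ⟨σ, view, hσ, hview, hγ⟩ := h
    obtain ⟨P, hP, hd⟩ := propagates_core hG hF hf v
      (Finset.mem_sdiff.2 ⟨Finset.mem_compl.2 hv, hvF⟩)
    rw [hγ v hvF]
    exact confirmed_of_paths card_le_floodLength hview hvF hv hP hd
      fun a ha _ => by rw [hσ a (Finset.mem_sdiff.1 ha).2, hδ a ha]

variable {γ : ℕ → V → Bool}

theorem exists_eq_of_phaseSteps (hF : F.card ≤ f)
    (h : ∀ i, PhaseStep G (floodLength G) F (consensusRule G f i) (γ i) (γ (i + 1)))
    {i j : ℕ} (hij : i ≤ j) : ∀ v ∉ F, ∃ w ∉ F, γ j v = γ i w := by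
  induction j, hij using Nat.le_induction with
  | base => exact fun v hv => ⟨v, hv, rfl⟩
  | succ j _ ih =>
    intro v hv
    obtain ⟨w, hw, e⟩ := (h j).exists_eq hF hv
    obtain ⟨w', hw', e'⟩ := ih w hw
    exact ⟨w', hw', e.trans e'⟩

theorem agreement_of_phaseSteps (hG : ConditionSCWith G f F) (hF : F.card ≤ f)
    (hf : f < Fintype.card V)
    (h : ∀ i, PhaseStep G (floodLength G) F (consensusRule G f i) (γ i) (γ (i + 1))) :
    ∃ b, ∀ v ∉ F, γ (3 * Fintype.card (Finset V)) v = b := by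
  obtain ⟨j, hj, hjF⟩ := List.getElem_of_mem (Finset.mem_toList.2 (Finset.mem_univ F))
  rw [Finset.length_toList, Finset.card_univ] at hj
  have hget : (Finset.univ : Finset (Finset V)).toList.getD j ∅ = F := by
    rw [← hjF, List.getD_eq_getElem]
  have hrule : ∀ r < 3, consensusRule G f (3 * j + r) =
      if r = 0 then LocalBroadcast.splitRule G f F
      else adopt G f F (core G F \ F) (decide (r = 1)) := by
    intro r hr
    have h1 : (3 * j + r) / 3 = j := by omega
    have h2 : (3 * j + r) % 3 = r := by omega
    simp only [consensusRule, h1, h2, hget]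
  have h0 := h (3 * j + 0)
  have h1 := h (3 * j + 1)
  have h2 := h (3 * j + 2)
  rw [hrule _ (by omega)] at h0 h1 h2
  simp only [if_true, OfNat.ofNat_ne_zero, one_ne_zero, if_false, decide_true] at h0 h1 h2
  obtain ⟨b, hb⟩ := h0.splitRule hG
  have hb1 : ∀ v ∈ core G F \ F, γ (3 * j + 2) v = b := fun v hv => by
    rw [h1.adopt_core v hv]; exact hb v hv
  -- The phase with `δ = true` comes first. If `b` is `true`, it spreads `b` and the next phase
  -- preserves unanimity; if `b` is `false`, it leaves the core outside `F` unchanged and the next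
  -- phase spreads `b`.
  have key : ∀ v ∉ F, γ (3 * j + 3) v = b := by
    cases b with
    | false => exact h2.adopt_core_eq hG hF hf hb1
    | true =>
      intro v hv
      obtain ⟨w, hw, e⟩ := (h (3 * j + 2)).exists_eq hF hv
      rw [e]
      exact h1.adopt_core_eq hG hF hf hb w hw
  refine ⟨b, fun v hv => ?_⟩
  obtain ⟨w, hw, e⟩ := exists_eq_of_phaseSteps hF h
    (show 3 * j + 3 ≤ 3 * Fintype.card (Finset V) by omega) v hv
  rw [e, key w hw]

end Rules

end LocalBroadcast

theorem mainTheorem3 {V : Type*} [Fintype V] [DecidableEq V] (G : Digraph V) (f : ℕ)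
    (hf : 0 < f) (hfn : f < Fintype.card V) (hG : LocalBroadcast.ConditionSC G f) :
    LocalBroadcast.ConsensusAchievable G f := by
  open LocalBroadcast in
  refine ⟨(flooding G (floodLength G) (consensusRule G f)).toAlgorithm
    (floodLength G * (3 * Fintype.card (Finset V))),
    ClockedProtocol.solvesConsensus_toAlgorithm fun F x byz hF => ?_⟩
  have hK : 0 < floodLength G := lt_of_lt_of_le (by omega) card_le_floodLength
  have h := fun i => floodState_phaseStep (G := G) (F := F) (x := x) (byz := byz)
    (rule := consensusRule G f) hK i
  obtain ⟨b, hb⟩ := agreement_of_phaseSteps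
    (γ := fun i v => (floodState G (floodLength G) (consensusRule G f) F x byz
      (floodLength G * i) v).1) (hG F hF) hF hfn h
  refine ⟨fun v hv w hw => (hb v hv).trans (hb w hw).symm, fun v hv => ?_⟩
  obtain ⟨w, hw, e⟩ := exists_eq_of_phaseSteps
    (γ := fun i v => (floodState G (floodLength G) (consensusRule G f) F x byz
      (floodLength G * i) v).1) hF h (Nat.zero_le (3 * Fintype.card (Finset V))) v hv
  exact ⟨w, hw, e.symm⟩
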